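/- Call a unital $C^*$-algebra $\mathcal A$ *$W^*$-$C^*$-projective* if for every von Neumann algebra $\mathcal B$, every unital $C^*$-algebra $\mathcal M$, every surjective unital $*$-homomorphism $\pi:\mathcal B\to\mathcal M$ and every unital $*$-homomorphism $\phi:\mathcal A\to\mathcal M$ there is a unital $*$-homomorphism $\psi:\mathcal A\to\mathcal B$ with $\pi\circ\psi=\phi$. A *Peano continuum* is a non-empty compact connected metric space that is locally connected at each point. **Proposition.** Let $K$ be a Peano continuum, and suppose that the $C^*$-algebra $C(K)$ of continuous complex-valued functions on $K$ is $W^*$-$C^*$-projective. Then the covering dimension of $K$ satisfies $\dim_{\mathrm{cov}}(K)\le 1$. -/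

import Mathlib

universe u v

/-- A unital C⋆-algebra `B` is a von Neumann algebra if it is ⋆-isomorphic to a ⋆-algebra of bounded
operators on a Hilbert space that equals its own double commutant. (Requiring the Hilbert space to
live in the same universe as `B` is no restriction: the direct sum of the GNS representations of all
normal states lives there.) -/
def IsVonNeumann (B : Type v) [CStarAlgebra B] : Prop :=
  ∃ (H : Type v) (_ : NormedAddCommGroup H) (_ : InnerProductSpace ℂ H) (_ : CompleteSpace H)
    (S : VonNeumannAlgebra H), Nonempty (B ≃⋆ₐ[ℂ] S.toStarSubalgebra)

/-- `X`-`Y` projectivity of a unital C⋆-algebra `A`, for classes `X`, `Y` of unital C⋆-algebras: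
every unital ⋆-homomorphism `A → M` with `M` in `Y` lifts through every surjective unital
⋆-homomorphism `B → M` with `B` in `X`. (The arrows `→⋆ₐ[ℂ]` are unital.) -/
def IsProjectiveFor (X Y : ∀ (B : Type v) [CStarAlgebra B], Prop)
    (A : Type u) [CStarAlgebra A] : Prop :=
  ∀ (B M : Type v) [CStarAlgebra B] [CStarAlgebra M], X B → Y M →
    ∀ π : B →⋆ₐ[ℂ] M, Function.Surjective π →
      ∀ φ : A →⋆ₐ[ℂ] M, ∃ ψ : A →⋆ₐ[ℂ] B, π.comp ψ = φ

/-- W*-C*-projectivity: lifting through all surjections from von Neumann algebras onto arbitrary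
unital C⋆-algebras (living in `Type v`). -/
def IsWStarCStarProjective (A : Type u) [CStarAlgebra A] : Prop :=
  IsProjectiveFor.{u, v} (fun B _ => IsVonNeumann B) (fun _ _ => True) A

/-- The covering dimension of `X` is at most `d`: every open cover of `X` has an open refinement
that covers `X` and such that each point lies in at most `d + 1` of its members. Here `d = ⊥`
plays the role of dimension `-1` (only the empty space), and `d = ⊤` imposes no bound. -/
def CoveringDimLE (X : Type u) [TopologicalSpace X] (d : WithBot ℕ∞) : Prop :=
  ∀ 𝒰 : Set (Set X), (∀ U ∈ 𝒰, IsOpen U) → ⋃₀ 𝒰 = Set.univ →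
    ∃ 𝒱 : Set (Set X), (∀ V ∈ 𝒱, IsOpen V) ∧ ⋃₀ 𝒱 = Set.univ ∧
      (∀ V ∈ 𝒱, ∃ U ∈ 𝒰, V ⊆ U) ∧
      ∀ x : X, (({V ∈ 𝒱 | x ∈ V}.encard : ℕ∞) : WithBot ℕ∞) ≤ d + 1

/-- The (Lebesgue) covering dimension. -/
noncomputable def coveringDim (X : Type u) [TopologicalSpace X] : WithBot ℕ∞ :=
  sInf {d | CoveringDimLE X d}

/-! Projectivity is tested on the quotient of `H →L[ℂ] H` by the compact operators. An isometry `V`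
with `1 - V * star V` compact becomes unitary there, so it gives a ⋆-homomorphism from `C(Circle,
ℂ)`. If some `f` on `K` had winding number one along a loop in `K`, lifting the induced map from
`C(K, ℂ)` would send `f` to a normal operator equal, modulo compacts, to `V` times a unitary. A
non-surjective isometry is never a compact perturbation of a normal operator
(`IsStarNormal.not_isCompactOperator_sub_isometry`, an index argument without the index), so no such
`f` exists (`IsWStarCStarProjective.false_of_winding_one`).

Suppose connected open sets `P`, `Q` meet in a set with `x`, `y` in different components. A path
from `x` to `y` in `P` followed by one back in `Q` is a loop, and a function winding once along it
can be built from a real function separating the components. Hence `HasConnectedIntersections`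
holds.

This property makes the connected open sets containing two given points directed downwards. By
compactness they share a third point, which cuts the two apart. Finite intersections of the
resulting open sets give a basis with finite frontiers, and this bounds the covering dimension by
one. -/

open Set Topology Filter

/-! ### Connected intersections and bases with finite frontiers -/

/-- In a regular locally connected space, two points of a connected open set `G` lie in a connected
open set whose closure is contained in `G`. -/
theorem IsPreconnected.exists_isOpen_closure_subset {X : Type*} [TopologicalSpace X]
    [RegularSpace X] [LocallyConnectedSpace X] {G : Set X} (hG : IsOpen G) (hc : IsPreconnected G)
    {x y : X} (hx : x ∈ G) (hy : y ∈ G) :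
    ∃ D, IsOpen D ∧ IsPreconnected D ∧ x ∈ D ∧ y ∈ D ∧ closure D ⊆ G := by
  refine hc.induction₂
    (fun x y => ∃ D, IsOpen D ∧ IsPreconnected D ∧ x ∈ D ∧ y ∈ D ∧ closure D ⊆ G) ?_ ?_ ?_ hx hy
  · intro x hx
    obtain ⟨F, hF, hFc, hFG⟩ := exists_mem_nhds_isClosed_subset (hG.mem_nhds hx)
    obtain ⟨D, hDF, hDo, hxD, hDc⟩ :=
      locallyConnectedSpace_iff_subsets_isOpen_isConnected.1 ‹_› x F hF
    filter_upwards [mem_nhdsWithin_of_mem_nhds (hDo.mem_nhds hxD)] with y hy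
    exact ⟨D, hDo, hDc.isPreconnected, hxD, hy, (closure_minimal hDF hFc).trans hFG⟩
  · rintro x y z - - - ⟨D, h1, h2, h3, h4, h5⟩ ⟨E, k1, k2, k3, k4, k5⟩
    exact ⟨D ∪ E, h1.union k1, h2.union y h4 k3 k2, .inl h3, .inr k4,
      by rw [closure_union]; exact union_subset h5 k5⟩
  · rintro x y - - ⟨D, h1, h2, h3, h4, h5⟩
    exact ⟨D, h1, h2, h4, h3, h5⟩

/-- Any two points of the intersection of two connected open sets lie in a connected open
subset of this intersection. -/
def HasConnectedIntersections (X : Type*) [TopologicalSpace X] : Prop :=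
  ∀ P Q : Set X, IsOpen P → IsPreconnected P → IsOpen Q → IsPreconnected Q →
    ∀ x ∈ P ∩ Q, ∀ y ∈ P ∩ Q, ∃ R ⊆ P ∩ Q, IsOpen R ∧ IsPreconnected R ∧ x ∈ R ∧ y ∈ R

namespace HasConnectedIntersections

variable {X : Type*} [TopologicalSpace X] [CompactSpace X] [T2Space X] [LocallyConnectedSpace X]

/-- Two distinct points have a third point in common to all connected open sets containing them. -/
theorem exists_forall_mem [ConnectedSpace X] (h : HasConnectedIntersections X) {x y : X}
    (hxy : x ≠ y) :
    ∃ z, z ≠ x ∧ z ≠ y ∧ ∀ G, IsOpen G → IsPreconnected G → x ∈ G → y ∈ G → z ∈ G := by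
  by_contra! hcon
  let ι := {G : Set X // IsOpen G ∧ IsPreconnected G ∧ x ∈ G ∧ y ∈ G}
  have : Nonempty ι := ⟨⟨univ, isOpen_univ, isPreconnected_univ, mem_univ _, mem_univ _⟩⟩
  obtain ⟨U, V, hU, hV, hxU, hyV, hd⟩ := t2_separation hxy
  have hdir : Directed (fun A B : Set X => A ⊇ B) (fun G : ι => closure (G : Set X)) := by
    rintro ⟨P, hP, hPc, hxP, hyP⟩ ⟨Q, hQ, hQc, hxQ, hyQ⟩
    obtain ⟨R, hR, hRo, hRc, hxR, hyR⟩ := h P Q hP hPc hQ hQc x ⟨hxP, hxQ⟩ y ⟨hyP, hyQ⟩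
    exact ⟨⟨R, hRo, hRc, hxR, hyR⟩, closure_mono (hR.trans inter_subset_left),
      closure_mono (hR.trans inter_subset_right)⟩
  -- Without a third common point the closures of these sets intersect only in `x` and `y`, since
  -- each set contains the closure of a smaller one. By compactness a single connected `G` then lies
  -- in `U ∪ V`, which separates `x` from `y`.
  obtain ⟨⟨G, hG, hGc, hxG, hyG⟩, hGs⟩ := exists_subset_nhds_of_isCompact (U := U ∪ V) hdir
    (fun G => isClosed_closure.isCompact) (by
      intro z hz
      apply (hU.union hV).mem_nhds
      by_cases hzx : z = x
      · exact .inl (hzx ▸ hxU)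
      by_cases hzy : z = y
      · exact .inr (hzy ▸ hyV)
      obtain ⟨G, hG, hGc, hxG, hyG, hzG⟩ := hcon z hzx hzy
      obtain ⟨D, hD, hDc, hxD, hyD, hDG⟩ := hGc.exists_isOpen_closure_subset hG hxG hyG
      exact absurd (hDG (mem_iInter.1 hz ⟨D, hD, hDc, hxD, hyD⟩)) hzG)
  obtain ⟨w, -, hwU, hwV⟩ := hGc U V hU hV (subset_closure.trans hGs) ⟨x, hxG, hxU⟩ ⟨y, hyG, hyV⟩
  exact hd.le_bot ⟨hwU, hwV⟩

/-- Take the component of `x` in the complement of the common point `z`. Components of an open set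
are open, so its frontier is at most `z`; it cannot contain `y`, as it would then contain `z`. -/
theorem exists_isOpen_finite_frontier_notMem_closure [ConnectedSpace X]
    (h : HasConnectedIntersections X) {x y : X} (hxy : x ≠ y) :
    ∃ C, IsOpen C ∧ x ∈ C ∧ (frontier C).Finite ∧ y ∉ closure C := by
  obtain ⟨z, hzx, hzy, hz⟩ := h.exists_forall_mem hxy
  have hzo : IsOpen ({z}ᶜ : Set X) := isOpen_compl_singleton
  have hCo : IsOpen (connectedComponentIn {z}ᶜ x) := hzo.connectedComponentIn
  have hxC : x ∈ connectedComponentIn {z}ᶜ x := mem_connectedComponentIn hzx.symm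
  have hcl : ∀ w ∈ closure (connectedComponentIn {z}ᶜ x), w ≠ z →
      w ∈ connectedComponentIn {z}ᶜ x := by
    intro w hw hwz
    obtain ⟨v, hv1, hv2⟩ := mem_closure_iff.1 hw _ (hzo.connectedComponentIn (x := w))
      (mem_connectedComponentIn hwz)
    rw [connectedComponentIn_eq hv2, ← connectedComponentIn_eq hv1]
    exact mem_connectedComponentIn hwz
  refine ⟨_, hCo, hxC, (finite_singleton z).subset ?_, ?_⟩
  · intro w hw
    by_contra hwz
    rw [hCo.frontier_eq] at hw
    exact hw.2 (hcl w hw.1 hwz)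
  · intro hy
    exact connectedComponentIn_subset _ _
      (hz _ hCo isPreconnected_connectedComponentIn hxC (hcl y hy hzy.symm)) rfl

/-- Compactness of `Uᶜ` reduces this to separating `x` from single points, because finite frontiers
survive finite intersections. -/
theorem exists_isOpen_finite_frontier_subset [ConnectedSpace X] (h : HasConnectedIntersections X)
    {x : X} {U : Set X} (hU : IsOpen U) (hx : x ∈ U) :
    ∃ W ⊆ U, IsOpen W ∧ x ∈ W ∧ (frontier W).Finite := by
  have key : ∃ W, IsOpen W ∧ x ∈ W ∧ (frontier W).Finite ∧ Disjoint Uᶜ W := by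
    refine hU.isClosed_compl.isCompact.induction_on
      (p := fun F => ∃ W, IsOpen W ∧ x ∈ W ∧ (frontier W).Finite ∧ Disjoint F W) ?_ ?_ ?_ ?_
    · exact ⟨univ, isOpen_univ, mem_univ _, by simp, by simp⟩
    · rintro s t hst ⟨W, h1, h2, h3, h4⟩
      exact ⟨W, h1, h2, h3, h4.mono_left hst⟩
    · rintro s t ⟨W, h1, h2, h3, h4⟩ ⟨V, k1, k2, k3, k4⟩
      refine ⟨W ∩ V, h1.inter k1, ⟨h2, k2⟩, (h3.union k3).subset ?_, ?_⟩
      · exact (frontier_inter_subset W V).trans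
          (union_subset_union inter_subset_left inter_subset_right)
      · exact disjoint_union_left.2 ⟨h4.mono_right inter_subset_left,
          k4.mono_right inter_subset_right⟩
    · intro y hy
      have hxy : x ≠ y := by rintro rfl; exact hy hx
      obtain ⟨C, h1, h2, h3, h4⟩ := h.exists_isOpen_finite_frontier_notMem_closure hxy
      exact ⟨(closure C)ᶜ, mem_nhdsWithin_of_mem_nhds (isClosed_closure.isOpen_compl.mem_nhds h4),
        C, h1, h2, h3, disjoint_compl_left.mono_right subset_closure⟩
  obtain ⟨W, h1, h2, h3, h4⟩ := key
  exact ⟨W, disjoint_compl_left_iff_subset.1 h4, h1, h2, h3⟩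

end HasConnectedIntersections

/-! ### Finite frontiers bound the covering dimension -/

/-- A compact Hausdorff space with a basis of open sets with finite frontiers has covering
dimension at most one. -/
theorem CoveringDimLE.one_of_finite_frontier {X : Type*} [TopologicalSpace X] [CompactSpace X]
    [T2Space X]
    (h : ∀ (x : X) (U : Set X), IsOpen U → x ∈ U →
      ∃ W ⊆ U, IsOpen W ∧ x ∈ W ∧ (frontier W).Finite) :
    CoveringDimLE X 1 := by
  intro 𝒰 hO hcov
  have h0 : ∀ x : X, ∃ U ∈ 𝒰, x ∈ U := fun x => mem_sUnion.1 (hcov ▸ mem_univ x)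
  choose U hU hxU using h0
  choose W hWU hWo hxW hWf using fun x => h x (U x) (hO _ (hU x)) (hxU x)
  obtain ⟨t, ht⟩ := isCompact_univ.elim_finite_subcover W hWo
    (fun x _ => mem_iUnion.2 ⟨x, hxW x⟩)
  let e := t.equivFin
  let w : Fin t.card → X := fun i => e.symm i
  -- Removing the closures of earlier sets makes the `V i` disjoint, and they miss only points of
  -- the finite set `E` of frontier points. Disjoint neighbourhoods of the points of `E` form a
  -- second family, so each point has order at most two.
  let V : Fin t.card → Set X := fun i => W (w i) \ ⋃ j ∈ Iio i, closure (W (w j))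
  have hVo : ∀ i, IsOpen (V i) := fun i =>
    (hWo _).sdiff ((finite_Iio i).isClosed_biUnion fun j _ => isClosed_closure)
  have hVd : ∀ i j x, x ∈ V i → x ∈ V j → i = j := by
    have aux : ∀ i j x, x ∈ V i → x ∈ V j → ¬ i < j := fun i j x hi hj hij =>
      hj.2 (mem_biUnion (show i ∈ Iio j from hij) (subset_closure hi.1))
    intro i j x hi hj
    exact le_antisymm (not_lt.1 (aux j i x hj hi)) (not_lt.1 (aux i j x hi hj))
  let E : Set X := ⋃ i, frontier (W (w i))
  have hE : E.Finite := finite_iUnion fun i => hWf _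
  obtain ⟨N, hN, hNd⟩ := hE.t2_separation
  have hcovV : ∀ x, x ∉ E → ∃ i, x ∈ V i := by
    intro x hx
    have hex : ∃ i, x ∈ closure (W (w i)) := by
      obtain ⟨y, hy, hxy⟩ := mem_iUnion₂.1 (ht (mem_univ x))
      exact ⟨e ⟨y, hy⟩, subset_closure (by simpa [w] using hxy)⟩
    obtain ⟨i, hi, hmin⟩ := WellFounded.has_min (wellFounded_lt (α := Fin t.card))
      {i | x ∈ closure (W (w i))} hex
    refine ⟨i, ?_, ?_⟩
    · by_contra hxi
      exact hx (mem_iUnion.2 ⟨i, by rw [(hWo _).frontier_eq]; exact ⟨hi, hxi⟩⟩)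
    · intro hm
      obtain ⟨j, hj, hxj⟩ := mem_iUnion₂.1 hm
      exact hmin j hxj hj
  refine ⟨range V ∪ (fun x => N x ∩ U x) '' E, ?_, ?_, ?_, ?_⟩
  · rintro _ (⟨i, rfl⟩ | ⟨x, -, rfl⟩)
    · exact hVo i
    · exact (hN x).2.inter (hO _ (hU x))
  · refine eq_univ_of_forall fun x => ?_
    by_cases hx : x ∈ E
    · exact mem_sUnion.2 ⟨_, .inr ⟨x, hx, rfl⟩, (hN x).1, hxU x⟩
    · obtain ⟨i, hi⟩ := hcovV x hx
      exact mem_sUnion.2 ⟨_, .inl ⟨i, rfl⟩, hi⟩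
  · rintro _ (⟨i, rfl⟩ | ⟨x, -, rfl⟩)
    · exact ⟨_, hU (w i), sdiff_subset.trans (hWU _)⟩
    · exact ⟨_, hU x, inter_subset_right⟩
  · intro x
    have hsub : {A ∈ range V ∪ (fun x => N x ∩ U x) '' E | x ∈ A} ⊆
        {A ∈ range V | x ∈ A} ∪ {A ∈ (fun x => N x ∩ U x) '' E | x ∈ A} := by
      rintro A ⟨hA | hA, hx⟩
      exacts [.inl ⟨hA, hx⟩, .inr ⟨hA, hx⟩]
    have h1 : {A ∈ range V | x ∈ A}.encard ≤ 1 := by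
      rw [encard_le_one_iff]
      rintro _ _ ⟨⟨i, rfl⟩, hi⟩ ⟨⟨j, rfl⟩, hj⟩
      rw [hVd i j x hi hj]
    have h2 : {A ∈ (fun x => N x ∩ U x) '' E | x ∈ A}.encard ≤ 1 := by
      rw [encard_le_one_iff]
      rintro _ _ ⟨⟨a, ha, rfl⟩, hxa⟩ ⟨⟨b, hb, rfl⟩, hxb⟩
      rw [hNd.elim_set ha hb x hxa.1 hxb.1]
    have h3 := (encard_le_encard hsub).trans ((encard_union_le _ _).trans (add_le_add h1 h2))
    exact WithBot.coe_le_coe.2 h3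

theorem coveringDim_le_one_of_hasConnectedIntersections {X : Type*} [TopologicalSpace X]
    [CompactSpace X] [T2Space X] [LocallyConnectedSpace X] [ConnectedSpace X]
    (h : HasConnectedIntersections X) : coveringDim X ≤ 1 :=
  sInf_le (CoveringDimLE.one_of_finite_frontier fun _ _ hU hx =>
    h.exists_isOpen_finite_frontier_subset hU hx)

/-! ### Chains of connected sets and local path connectedness -/

/-- A finite chain of points `p 0, …, p m`, consecutive ones lying in common links `D i`. -/
structure LinkedChain (X : Type*) where
  length : ℕ
  point : ℕ → X
  link : ℕ → Set X

/-- The chain `c` runs from `x` to `y` through connected open links of diameter at most `ε`. -/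
structure LinkedChain.Joins {X : Type*} [MetricSpace X] (c : LinkedChain X) (ε : ℝ) (x y : X) :
    Prop where
  length_pos : 0 < c.length
  point_zero : c.point 0 = x
  point_length : c.point c.length = y
  isOpen_link : ∀ i < c.length, IsOpen (c.link i)
  isPreconnected_link : ∀ i < c.length, IsPreconnected (c.link i)
  point_mem : ∀ i < c.length, c.point i ∈ c.link i
  point_succ_mem : ∀ i < c.length, c.point (i + 1) ∈ c.link i
  dist_le : ∀ i < c.length, ∀ a ∈ c.link i, ∀ b ∈ c.link i, dist a b ≤ ε

theorem exists_isOpen_isPreconnected_dist_le {X : Type*} [MetricSpace X] [LocallyConnectedSpace X]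
    {C : Set X} (hC : IsOpen C) {x : X} (hx : x ∈ C) {ε : ℝ} (hε : 0 < ε) :
    ∃ D ⊆ C, IsOpen D ∧ IsPreconnected D ∧ x ∈ D ∧ ∀ a ∈ D, ∀ b ∈ D, dist a b ≤ ε := by
  obtain ⟨D, hDF, hDo, hxD, hDc⟩ :=
    locallyConnectedSpace_iff_subsets_isOpen_isConnected.1 ‹_› x (C ∩ Metric.ball x (ε / 2))
      (inter_mem (hC.mem_nhds hx) (Metric.ball_mem_nhds x (by positivity)))
  refine ⟨D, hDF.trans inter_subset_left, hDo, hDc.isPreconnected, hxD, fun a ha b hb => ?_⟩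
  have h1 := Metric.mem_ball.1 (hDF ha).2
  have h2 := Metric.mem_ball'.1 (hDF hb).2
  linarith [dist_triangle a x b]

/-- In a connected open set, any two points are joined by a chain of connected open sets of small
diameter; the chain may be taken of any sufficiently large length. -/
theorem IsPreconnected.exists_chain {X : Type*} [MetricSpace X] [LocallyConnectedSpace X]
    {C : Set X} (hC : IsOpen C) (hc : IsPreconnected C) {ε : ℝ} (hε : 0 < ε) {x y : X}
    (hx : x ∈ C) (hy : y ∈ C) :
    ∃ N, ∀ n ≥ N, ∃ (p : ℕ → X) (D : ℕ → Set X), p 0 = x ∧ p n = y ∧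
      ∀ i < n, D i ⊆ C ∧ IsOpen (D i) ∧ IsPreconnected (D i) ∧ p i ∈ D i ∧ p (i + 1) ∈ D i ∧
        ∀ a ∈ D i, ∀ b ∈ D i, dist a b ≤ ε := by
  have key : ∃ N, ∃ (p : ℕ → X) (D : ℕ → Set X), p 0 = x ∧ p N = y ∧
      ∀ i < N, D i ⊆ C ∧ IsOpen (D i) ∧ IsPreconnected (D i) ∧ p i ∈ D i ∧ p (i + 1) ∈ D i ∧
        ∀ a ∈ D i, ∀ b ∈ D i, dist a b ≤ ε := by
    refine hc.induction₂ (fun x y => ∃ N, ∃ (p : ℕ → X) (D : ℕ → Set X), p 0 = x ∧ p N = y ∧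
      ∀ i < N, D i ⊆ C ∧ IsOpen (D i) ∧ IsPreconnected (D i) ∧ p i ∈ D i ∧ p (i + 1) ∈ D i ∧
        ∀ a ∈ D i, ∀ b ∈ D i, dist a b ≤ ε) ?_ ?_ ?_ hx hy
    · intro x hx
      obtain ⟨D, hDC, hDo, hDc, hxD, hD⟩ := exists_isOpen_isPreconnected_dist_le hC hx hε
      filter_upwards [mem_nhdsWithin_of_mem_nhds (hDo.mem_nhds hxD)] with y hy
      refine ⟨1, fun i => if i = 0 then x else y, fun _ => D, by simp, by simp, fun i hi => ?_⟩
      obtain rfl : i = 0 := by omega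
      exact ⟨hDC, hDo, hDc, by simpa, by simpa, hD⟩
    · rintro x y z - - - ⟨N, p, D, h0, h1, h2⟩ ⟨M, q, E, k0, k1, k2⟩
      refine ⟨N + M, fun i => if i < N then p i else q (i - N),
        fun i => if i < N then D i else E (i - N), ?_, ?_, fun i hi => ?_⟩
      · by_cases hN : 0 < N
        · simp [hN, h0]
        · obtain rfl : N = 0 := by omega
          simp [k0, ← h0, h1]
      · simp [k1]
      · by_cases hiN : i < N
        · have hs : (if i + 1 < N then p (i + 1) else q (i + 1 - N)) = p (i + 1) := by
            split_ifs with h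
            · rfl
            · obtain rfl : i + 1 = N := by omega
              simp [k0, h1]
          simp only [hiN, if_true, hs]
          exact h2 i hiN
        · have h3 : i + 1 - N = (i - N) + 1 := by omega
          have h4 : ¬ i + 1 < N := by omega
          simp only [hiN, if_false, h4, h3]
          exact k2 (i - N) (by omega)
    · rintro x y - - ⟨N, p, D, h0, h1, h2⟩
      refine ⟨N, fun i => p (N - i), fun i => D (N - (i + 1)), by simpa, by simpa, fun i hi => ?_⟩
      obtain ⟨a1, a2, a3, a4, a5, a6⟩ := h2 (N - (i + 1)) (by omega)
      rw [show N - (i + 1) + 1 = N - i by omega] at a5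
      exact ⟨a1, a2, a3, a5, a4, a6⟩
  obtain ⟨N, p, D, h0, h1, h2⟩ := key
  -- Longer chains are obtained by repeating `y`, with `D'` as the link at each repetition.
  obtain ⟨D', hDC, hDo, hDc, hyD, hD⟩ := exists_isOpen_isPreconnected_dist_le hC hy hε
  refine ⟨N, fun n hn => ⟨fun i => p (min i N), fun i => if i < N then D i else D', by simpa,
    by simpa [hn], fun i hi => ?_⟩⟩
  by_cases hiN : i < N
  · have h3 : min i N = i := by omega
    have h4 : min (i + 1) N = i + 1 := by omega
    simp only [hiN, if_true, h3, h4]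
    exact h2 i hiN
  · have h3 : min i N = N := by omega
    have h4 : min (i + 1) N = N := by omega
    simp only [hiN, if_false, h3, h4, h1]
    exact ⟨hDC, hDo, hDc, hyD, hyD, hD⟩

namespace LinkedChain

variable {X : Type*} [MetricSpace X]

/-- The chain `c'` subdivides every step of `c` into the same number of steps, with links inside
the links of `c`. -/
def Refines (c' c : LinkedChain X) : Prop :=
  ∃ n, 0 < n ∧ c'.length = c.length * n ∧ ∀ j < c'.length, c'.link j ⊆ c.link (j / n)

/-- Each link is itself connected and open, so its two marked points are joined by a finer chain
inside it. Padding gives all steps the same number of parts, which keeps the links nested at every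
fixed parameter `t`. -/
theorem Joins.exists_refines [LocallyConnectedSpace X] {c : LinkedChain X} {ε : ℝ} {x y : X}
    (hc : c.Joins ε x y) {δ : ℝ} (hδ : 0 < δ) : ∃ c' : LinkedChain X, c'.Joins δ x y ∧
      c'.Refines c := by
  have h1 : ∀ i : ℕ, ∃ N, i < c.length → ∀ n ≥ N, ∃ (p : ℕ → X) (D : ℕ → Set X),
      p 0 = c.point i ∧ p n = c.point (i + 1) ∧
      ∀ k < n, D k ⊆ c.link i ∧ IsOpen (D k) ∧ IsPreconnected (D k) ∧ p k ∈ D k ∧ p (k + 1) ∈ D k ∧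
        ∀ a ∈ D k, ∀ b ∈ D k, dist a b ≤ δ := by
    intro i
    by_cases hi : i < c.length
    · obtain ⟨N, hN⟩ := (hc.isPreconnected_link i hi).exists_chain (hc.isOpen_link i hi) hδ
        (hc.point_mem i hi) (hc.point_succ_mem i hi)
      exact ⟨N, fun _ => hN⟩
    · exact ⟨0, fun h => absurd h hi⟩
  choose N hN using h1
  let n := (Finset.range c.length).sup N + 1
  have hn : 0 < n := Nat.succ_pos _
  have h2 : ∀ i : ℕ, ∃ (p : ℕ → X) (D : ℕ → Set X), i < c.length →
      p 0 = c.point i ∧ p n = c.point (i + 1) ∧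
      ∀ k < n, D k ⊆ c.link i ∧ IsOpen (D k) ∧ IsPreconnected (D k) ∧ p k ∈ D k ∧ p (k + 1) ∈ D k ∧
        ∀ a ∈ D k, ∀ b ∈ D k, dist a b ≤ δ := by
    intro i
    by_cases hi : i < c.length
    · obtain ⟨p, D, h⟩ := hN i hi n
        ((Finset.le_sup (f := N) (Finset.mem_range.2 hi)).trans (Nat.le_succ _))
      exact ⟨p, D, fun _ => h⟩
    · exact ⟨fun _ => x, fun _ => ∅, fun h => absurd h hi⟩
  choose q E h using h2
  -- Index `j` is position `j % n` in the subdivision of step `j / n`; the default `y` supplies the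
  -- final point `j = c.length * n`.
  let p' : ℕ → X := fun j => if j < c.length * n then q (j / n) (j % n) else y
  have hdiv : ∀ j < c.length * n, j / n < c.length := fun j hj =>
    (Nat.div_lt_iff_lt_mul hn).2 hj
  have hsucc : ∀ j < c.length * n, p' (j + 1) = q (j / n) (j % n + 1) := by
    intro j hj
    have hm : j % n < n := Nat.mod_lt _ hn
    have hjd : j = n * (j / n) + j % n := (Nat.div_add_mod j n).symm
    obtain ⟨-, hlast, -⟩ := h _ (hdiv j hj)
    by_cases hjm : j % n + 1 < n
    · have e1 : (j + 1) / n = j / n := by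
        have hcomm := mul_comm n (j / n)
        rw [Nat.div_eq_iff hn]
        constructor <;> omega
      have e2 : (j + 1) % n = j % n + 1 := by
        have := Nat.div_add_mod (j + 1) n
        rw [e1] at this
        omega
      have e3 : j + 1 < c.length * n := by
        have := (Nat.div_lt_iff_lt_mul hn).1 (e1 ▸ hdiv j hj)
        exact this
      simp only [p', e3, if_true, e1, e2]
    · have hjm' : j % n + 1 = n := by omega
      have e0 : j + 1 = n * (j / n + 1) := by rw [Nat.mul_succ]; omega
      rw [hjm', hlast]
      by_cases e3 : j / n + 1 < c.length
      · have e4 : j + 1 < c.length * n := by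
          rw [e0, mul_comm]; exact Nat.mul_lt_mul_of_pos_right e3 hn
        have e5 : (j + 1) / n = j / n + 1 := by rw [e0, Nat.mul_div_cancel_left _ hn]
        have e6 : (j + 1) % n = 0 := by rw [e0, Nat.mul_mod_right]
        simp only [p', e4, if_true, e5, e6]
        exact (h _ e3).1
      · have e4 : j / n + 1 = c.length := by have := hdiv j hj; omega
        have e5 : ¬ j + 1 < c.length * n := by rw [e0, e4, mul_comm]; exact lt_irrefl _
        simp only [p', e5, if_false, e4, hc.point_length]
  refine ⟨⟨c.length * n, p', fun j => E (j / n) (j % n)⟩, ?_, n, hn, rfl, ?_⟩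
  · have hE : ∀ j < c.length * n, _ := fun j hj =>
      (h _ (hdiv j hj)).2.2 (j % n) (Nat.mod_lt _ hn)
    refine ⟨Nat.mul_pos hc.length_pos hn, ?_, ?_, fun j hj => (hE j hj).2.1,
      fun j hj => (hE j hj).2.2.1, fun j hj => ?_, fun j hj => ?_, fun j hj => (hE j hj).2.2.2.2.2⟩
    · simp only [p', Nat.mul_pos hc.length_pos hn, if_true, Nat.zero_div, Nat.zero_mod,
        (h 0 hc.length_pos).1, hc.point_zero]
    · simp [p']
    · have hj' : j < c.length * n := hj
      simp only [p', hj', if_true]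
      exact (hE j hj).2.2.2.1
    · simp only [hsucc j hj]
      exact (hE j hj).2.2.2.2.1
  · intro j hj
    exact ((h _ (hdiv j hj)).2.2 (j % n) (Nat.mod_lt _ hn)).1

/-- The step function on `[0, 1]` through the points of a chain. -/
noncomputable def step (c : LinkedChain X) (t : ℝ) : X := c.point ⌊t * c.length⌋₊

theorem floor_mul_lt_length {X : Type*} {c : LinkedChain X} (hc : 0 < c.length)
    {t : ℝ} (ht : t < 1) :
    ⌊t * c.length⌋₊ < c.length := by
  have h : (0 : ℝ) < c.length := by exact_mod_cast hc
  rw [Nat.floor_lt' hc.ne']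
  nlinarith

/-- Parameters closer than `1 / c.length` have indices differing by at most one, so both points lie
in one link. -/
theorem Joins.dist_step_le_of_le {c : LinkedChain X} {ε : ℝ} {x y : X} (hc : c.Joins ε x y)
    (hε : 0 ≤ ε) {s t : ℝ} (hs : 0 ≤ s) (hst : s ≤ t) (ht : t ≤ 1) (h : t - s < 1 / c.length) :
    dist (c.step s) (c.step t) ≤ ε := by
  have hm : (0 : ℝ) < c.length := by exact_mod_cast hc.length_pos
  have h1 : ⌊s * c.length⌋₊ ≤ ⌊t * c.length⌋₊ := Nat.floor_mono (by gcongr)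
  have h2 : ⌊t * c.length⌋₊ ≤ ⌊s * c.length⌋₊ + 1 := by
    rw [← Nat.floor_add_one (by positivity)]
    apply Nat.floor_mono
    rw [lt_div_iff₀ hm] at h
    linarith
  rcases Nat.eq_or_lt_of_le h1 with h3 | h3
  · simp [step, h3, hε]
  · have h4 : ⌊t * c.length⌋₊ = ⌊s * c.length⌋₊ + 1 := by omega
    have hs1 : s < 1 := by
      rcases hst.eq_or_lt with rfl | h5
      · exact absurd h3 (lt_irrefl _)
      · linarith
    have h6 := floor_mul_lt_length hc.length_pos hs1
    rw [step, step, h4]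
    exact hc.dist_le _ h6 _ (hc.point_mem _ h6) _ (hc.point_succ_mem _ h6)

theorem Joins.step_mem {c : LinkedChain X} {ε : ℝ} {x y : X} (hc : c.Joins ε x y) {t : ℝ}
    (ht : t < 1) : c.step t ∈ c.link ⌊t * c.length⌋₊ :=
  hc.point_mem _ (floor_mul_lt_length hc.length_pos ht)

theorem Refines.link_subset {X : Type*} {c c' : LinkedChain X} (h : c'.Refines c)
    (hc : 0 < c'.length) {t : ℝ} (ht : t < 1) : c'.link ⌊t * c'.length⌋₊ ⊆ c.link ⌊t * c.length⌋₊ := by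
  obtain ⟨n, hn, hl, hs⟩ := h
  have h1 := hs _ (floor_mul_lt_length hc ht)
  have hn' : (n : ℝ) ≠ 0 := by exact_mod_cast hn.ne'
  rw [← Nat.floor_div_natCast] at h1
  have h2 : t * c'.length / n = t * c.length := by
    rw [hl]; push_cast; field_simp
  rwa [h2] at h1

theorem Joins.step_zero {c : LinkedChain X} {ε : ℝ} {x y : X} (hc : c.Joins ε x y) :
    c.step 0 = x := by simp [step, hc.point_zero]

theorem Joins.step_one {c : LinkedChain X} {ε : ℝ} {x y : X} (hc : c.Joins ε x y) :
    c.step 1 = y := by simp [step, hc.point_length]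

end LinkedChain

/-- In a complete locally connected metric space, any two points of a connected open set are joined
by a path in the closure of this set. -/
theorem IsPreconnected.joinedIn_closure {X : Type*} [MetricSpace X] [CompleteSpace X]
    [LocallyConnectedSpace X] {C : Set X} (hC : IsOpen C) (hc : IsPreconnected C) {x y : X}
    (hx : x ∈ C) (hy : y ∈ C) : JoinedIn (closure C) x y := by
  -- The shape `C / 2 / 2 ^ k`, with `C = 2`, is the one the geometric Cauchy criterion expects.
  let ε : ℕ → ℝ := fun k => 2 / 2 / 2 ^ k
  have hε : ∀ k, 0 < ε k := fun k => by positivity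
  have hstart : ∃ c : LinkedChain X, c.Joins (ε 0) x y ∧ ∀ i < c.length, c.link i ⊆ C := by
    obtain ⟨N, hN⟩ := hc.exists_chain hC (hε 0) hx hy
    obtain ⟨p, D, h0, h1, h2⟩ := hN (N + 1) (Nat.le_succ _)
    exact ⟨⟨N + 1, p, D⟩, ⟨Nat.succ_pos _, h0, h1, fun i hi => (h2 i hi).2.1,
      fun i hi => (h2 i hi).2.2.1, fun i hi => (h2 i hi).2.2.2.1, fun i hi => (h2 i hi).2.2.2.2.1,
      fun i hi => (h2 i hi).2.2.2.2.2⟩, fun i hi => (h2 i hi).1⟩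
  obtain ⟨c₀, hc₀, hc₀C⟩ := hstart
  have hstep : ∀ (k : ℕ) (c : {c : LinkedChain X // c.Joins (ε k) x y}),
      ∃ c' : {c : LinkedChain X // c.Joins (ε (k + 1)) x y}, c'.1.Refines c.1 := by
    rintro k ⟨c, hc⟩
    obtain ⟨c', h1, h2⟩ := hc.exists_refines (hε (k + 1))
    exact ⟨⟨c', h1⟩, h2⟩
  choose next hnext using hstep
  let c : ∀ k : ℕ, {c : LinkedChain X // c.Joins (ε k) x y} := fun k =>
    Nat.rec ⟨c₀, hc₀⟩ (fun k c => next k c) k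
  have hJ : ∀ k, (c k).1.Joins (ε k) x y := fun k => (c k).2
  have hR : ∀ k, (c (k + 1)).1.Refines (c k).1 := fun k => hnext k (c k)
  let f : ℕ → ℝ → X := fun k t => (c k).1.step t
  have hmemC : ∀ k, ∀ t ≤ 1, f k t ∈ C := by
    intro k t ht
    rcases ht.eq_or_lt with rfl | ht
    · rw [show f k 1 = y from (hJ k).step_one]; exact hy
    · have h1 : ∀ k, (c k).1.link ⌊t * (c k).1.length⌋₊ ⊆ C := by
        intro k
        induction k with
        | zero => exact hc₀C _ (LinkedChain.floor_mul_lt_length hc₀.length_pos ht)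
        | succ k ih => exact ((hR k).link_subset (hJ (k + 1)).length_pos ht).trans ih
      exact h1 k ((hJ k).step_mem ht)
  have hdist : ∀ t ≤ 1, ∀ k, dist (f k t) (f (k + 1) t) ≤ 2 / 2 / 2 ^ k := by
    intro t ht k
    rcases ht.eq_or_lt with rfl | ht
    · rw [show f k 1 = y from (hJ k).step_one, show f (k + 1) 1 = y from (hJ (k + 1)).step_one,
        dist_self]
      exact (hε k).le
    · exact (hJ k).dist_le _ (LinkedChain.floor_mul_lt_length (hJ k).length_pos ht) _
        ((hJ k).step_mem ht) _
        ((hR k).link_subset (hJ (k + 1)).length_pos ht ((hJ (k + 1)).step_mem ht))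
  have hlim : ∀ t : unitInterval, ∃ z, Tendsto (fun k => f k t) atTop (𝓝 z) := fun t =>
    cauchySeq_tendsto_of_complete (cauchySeq_of_le_geometric_two (hdist t t.2.2))
  choose F hF using hlim
  have hFd : ∀ (t : unitInterval) k, dist (f k t) (F t) ≤ 2 / 2 ^ k := fun t k =>
    dist_le_of_le_geometric_two_of_tendsto (hdist t t.2.2) (hF t) k
  have hcont : Continuous F := by
    rw [Metric.continuous_iff]
    intro t δ hδ
    -- The five counts `2 / 2 ^ k` twice, for passing to the limit at `s` and at `t`, and the
    -- oscillation `ε k = 1 / 2 ^ k` of the step function.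
    obtain ⟨k, hk⟩ : ∃ k : ℕ, 5 * (1 / 2 : ℝ) ^ k < δ := by
      obtain ⟨k, hk⟩ := exists_pow_lt_of_lt_one (show 0 < δ / 5 by positivity)
        (show (1 / 2 : ℝ) < 1 by norm_num)
      exact ⟨k, by linarith⟩
    have hm : (0 : ℝ) < (c k).1.length := by exact_mod_cast (hJ k).length_pos
    refine ⟨1 / (c k).1.length, by positivity, fun s hs => ?_⟩
    have h1 : dist (f k s) (f k t) ≤ ε k := by
      have hs' : |(s : ℝ) - t| < 1 / (c k).1.length := hs
      rw [abs_lt] at hs'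
      rcases le_total (s : ℝ) t with h | h
      · exact (hJ k).dist_step_le_of_le (hε k).le s.2.1 h t.2.2 (by linarith)
      · rw [dist_comm]
        exact (hJ k).dist_step_le_of_le (hε k).le t.2.1 h s.2.2 (by linarith)
    have h2 := hFd s k
    have h3 := hFd t k
    rw [dist_comm] at h2
    have h4 : dist (F s) (F t) ≤ 2 / 2 ^ k + ε k + 2 / 2 ^ k :=
      (dist_triangle4 _ _ _ _).trans (by gcongr)
    have h5 : 2 / 2 ^ k + ε k + 2 / 2 ^ k = 5 * (1 / 2 : ℝ) ^ k := by
      simp only [ε, div_pow, one_pow]; ring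
    linarith
  refine ⟨⟨⟨F, hcont⟩, ?_, ?_⟩, fun t => ?_⟩
  · refine tendsto_nhds_unique (hF 0) ?_
    rw [show (fun k => f k ((0 : unitInterval) : ℝ)) = fun _ => x from
      funext fun k => (hJ k).step_zero]
    exact tendsto_const_nhds
  · refine tendsto_nhds_unique (hF 1) ?_
    rw [show (fun k => f k ((1 : unitInterval) : ℝ)) = fun _ => y from
      funext fun k => (hJ k).step_one]
    exact tendsto_const_nhds
  · exact mem_closure_of_tendsto (hF t) (Eventually.of_forall fun k => hmemC k t t.2.2)

/-- A complete locally connected metric space is locally path connected. -/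
theorem locallyPathConnectedSpace_of_completeSpace (X : Type*) [MetricSpace X] [CompleteSpace X]
    [LocallyConnectedSpace X] : LocallyPathConnectedSpace X := by
  rw [locallyPathConnectedSpace_iff_pathComponentIn_mem_nhds]
  intro x U hU hx
  obtain ⟨F, hF, hFc, hFU⟩ := exists_mem_nhds_isClosed_subset (hU.mem_nhds hx)
  obtain ⟨D, hDF, hDo, hxD, hDc⟩ :=
    locallyConnectedSpace_iff_subsets_isOpen_isConnected.1 ‹_› x F hF
  filter_upwards [hDo.mem_nhds hxD] with y hy
  exact (hDc.isPreconnected.joinedIn_closure hDo hxD hy).mono ((closure_minimal hDF hFc).trans hFU)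

/-! ### Quotient C⋆-algebras -/

/-- A closed two-sided ideal of a C⋆-algebra that is stable under `star` and has approximate
units `p` with `‖1 - p‖ ≤ 1`. -/
class Ideal.IsApproximatelyUnital {A : Type*} [CStarAlgebra A] (J : Ideal A) : Prop
    extends J.IsTwoSided where
  isClosed : IsClosed (J : Set A)
  star_mem : ∀ a ∈ J, star a ∈ J
  exists_approx : ∀ a ∈ J, ∀ ε > 0, ∃ p ∈ J, ‖1 - p‖ ≤ 1 ∧ ‖a * (1 - p)‖ ≤ ε

namespace Ideal.IsApproximatelyUnital

variable {A : Type*} [CStarAlgebra A] (J : Ideal A) [J.IsApproximatelyUnital]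

instance : IsClosed (J : Set A) := isClosed

theorem norm_mk_le_norm_mul (a : A) {p : A} (hp : p ∈ J) :
    ‖Ideal.Quotient.mk J a‖ ≤ ‖a * (1 - p)‖ := by
  have h : Ideal.Quotient.mk J a = Ideal.Quotient.mk J (a * (1 - p)) := by
    rw [Ideal.Quotient.eq, mul_sub, mul_one, sub_sub_cancel]
    exact J.mul_mem_left a hp
  rw [h]
  exact Submodule.Quotient.norm_mk_le _ _

/-- A near-optimal representative `b` differs from `a` by an element of `J`, which `1 - p` nearly
annihilates, while `b * (1 - p)` is no larger than `b`. -/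
theorem exists_norm_mul_le (a : A) {ε : ℝ} (hε : 0 < ε) :
    ∃ p ∈ J, ‖1 - p‖ ≤ 1 ∧ ‖a * (1 - p)‖ ≤ ‖Ideal.Quotient.mk J a‖ + ε := by
  obtain ⟨b, hb, hbn⟩ :=
    Submodule.Quotient.norm_mk_lt (S := J) (Ideal.Quotient.mk J a) (half_pos hε)
  have hab : a - b ∈ J := (Ideal.Quotient.eq (I := J)).1 hb.symm
  obtain ⟨p, hp, hp1, hp2⟩ := exists_approx (a - b) hab (ε / 2) (half_pos hε)
  refine ⟨p, hp, hp1, ?_⟩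
  have h1 : a * (1 - p) = b * (1 - p) + (a - b) * (1 - p) := by noncomm_ring
  have h2 : ‖b * (1 - p)‖ ≤ ‖b‖ :=
    (norm_mul_le _ _).trans (mul_le_of_le_one_right (norm_nonneg _) hp1)
  rw [h1]
  linarith [norm_add_le (b * (1 - p)) ((a - b) * (1 - p))]

noncomputable instance : NormedRing (A ⧸ J) where
  __ := (Ideal.Quotient.ring J)
  __ := (Submodule.Quotient.normedAddCommGroup J)
  norm_mul_le x y := by
    refine le_of_forall_pos_le_add fun ε hε => ?_
    obtain ⟨a, rfl⟩ := Ideal.Quotient.mk_surjective x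
    obtain ⟨b, rfl⟩ := Ideal.Quotient.mk_surjective y
    have hcont : Tendsto
        (fun δ : ℝ => (‖Ideal.Quotient.mk J a‖ + δ) * (‖Ideal.Quotient.mk J b‖ + δ))
        (𝓝[>] 0) (𝓝 (‖Ideal.Quotient.mk J a‖ * ‖Ideal.Quotient.mk J b‖)) := by
      refine Tendsto.mono_left ?_ nhdsWithin_le_nhds
      refine Continuous.tendsto' (by fun_prop) _ _ (by simp)
    refine (ge_of_tendsto hcont ?_).trans (le_add_of_nonneg_right hε.le)
    filter_upwards [self_mem_nhdsWithin] with δ hδ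
    obtain ⟨a', ha, ha'⟩ := Submodule.Quotient.norm_mk_lt (S := J) (Ideal.Quotient.mk J a) hδ
    obtain ⟨b', hb, hb'⟩ := Submodule.Quotient.norm_mk_lt (S := J) (Ideal.Quotient.mk J b) hδ
    have h1 : Ideal.Quotient.mk J a * Ideal.Quotient.mk J b = Ideal.Quotient.mk J (a' * b') := by
      rw [map_mul]; exact congrArg₂ (· * ·) ha.symm hb.symm
    calc _ = ‖Ideal.Quotient.mk J (a' * b')‖ := congrArg norm h1
      _ ≤ ‖a' * b'‖ := Submodule.Quotient.norm_mk_le _ _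
      _ ≤ ‖a'‖ * ‖b'‖ := norm_mul_le _ _
      _ ≤ _ := mul_le_mul ha'.le hb'.le (norm_nonneg _) ((norm_nonneg _).trans ha'.le)

noncomputable instance : NormedAlgebra ℂ (A ⧸ J) where
  __ := (Ideal.Quotient.algebra ℂ : Algebra ℂ (A ⧸ J))
  norm_smul_le := (Submodule.Quotient.normedSpace J ℂ).norm_smul_le

noncomputable instance : StarRing (A ⧸ J) where
  star := Quotient.map' star fun a b h => by
    rw [Submodule.quotientRel_def] at h ⊢
    rw [← star_sub]
    exact star_mem _ h
  star_involutive x := by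
    obtain ⟨a, rfl⟩ := Ideal.Quotient.mk_surjective x
    exact congrArg (Ideal.Quotient.mk J) (star_star a)
  star_mul x y := by
    obtain ⟨a, rfl⟩ := Ideal.Quotient.mk_surjective x
    obtain ⟨b, rfl⟩ := Ideal.Quotient.mk_surjective y
    exact congrArg (Ideal.Quotient.mk J) (star_mul a b)
  star_add x y := by
    obtain ⟨a, rfl⟩ := Ideal.Quotient.mk_surjective x
    obtain ⟨b, rfl⟩ := Ideal.Quotient.mk_surjective y
    exact congrArg (Ideal.Quotient.mk J) (star_add a b)

theorem star_mk (a : A) : star (Ideal.Quotient.mk J a) = Ideal.Quotient.mk J (star a) := rfl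

/-- The quotient of a C⋆-algebra by an approximately unital ideal. -/
noncomputable instance : CStarAlgebra (A ⧸ J) where
  __ := (inferInstance : NormedRing (A ⧸ J))
  __ := (inferInstance : StarRing (A ⧸ J))
  __ := (inferInstance : NormedAlgebra ℂ (A ⧸ J))
  complete := (Submodule.Quotient.completeSpace J).complete
  norm_mul_self_le x := by
    obtain ⟨a, rfl⟩ := Ideal.Quotient.mk_surjective x
    rw [star_mk, ← map_mul]
    refine le_of_forall_pos_le_add fun ε hε => ?_
    -- The C⋆-identity in `A`, applied to `a * (1 - p)`, passes to the quotient because the left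
    -- factor `star (1 - p)` is a contraction.
    obtain ⟨p, hp, hp1, hp2⟩ := exists_norm_mul_le J (star a * a) hε
    calc _ ≤ ‖a * (1 - p)‖ * ‖a * (1 - p)‖ := by
          gcongr <;> exact norm_mk_le_norm_mul J a hp
      _ = ‖star (a * (1 - p)) * (a * (1 - p))‖ := (CStarRing.norm_star_mul_self).symm
      _ = ‖star (1 - p) * (star a * a * (1 - p))‖ := by rw [star_mul]; noncomm_ring
      _ ≤ ‖star (1 - p)‖ * ‖star a * a * (1 - p)‖ := norm_mul_le _ _
      _ ≤ ‖star a * a * (1 - p)‖ :=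
          mul_le_of_le_one_left (norm_nonneg _) (by rwa [norm_star])
      _ ≤ _ := hp2
  star_smul c x := by
    obtain ⟨a, rfl⟩ := Ideal.Quotient.mk_surjective x
    exact congrArg (Ideal.Quotient.mk J) (star_smul c a)

/-- The quotient map as a ⋆-homomorphism. -/
noncomputable def mkStarAlgHom : A →⋆ₐ[ℂ] A ⧸ J where
  __ := Ideal.Quotient.mkₐ ℂ J
  map_star' a := (star_mk J a).symm

theorem mkStarAlgHom_surjective : Function.Surjective (mkStarAlgHom J) :=
  Ideal.Quotient.mk_surjective

theorem mkStarAlgHom_eq_iff {a b : A} : mkStarAlgHom J a = mkStarAlgHom J b ↔ a - b ∈ J :=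
  Ideal.Quotient.eq

end Ideal.IsApproximatelyUnital

/-! ### The ideal of compact operators -/

section CompactOperators

variable (H : Type*) [NormedAddCommGroup H] [InnerProductSpace ℂ H]

/-- The ideal of compact operators on a Hilbert space. -/
def compactOperatorIdeal : Ideal (H →L[ℂ] H) where
  carrier := {T | IsCompactOperator T}
  zero_mem' := isCompactOperator_zero
  add_mem' := IsCompactOperator.add
  smul_mem' S _ hT := hT.clm_comp S

variable {H}

theorem mem_compactOperatorIdeal {T : H →L[ℂ] H} :
    T ∈ compactOperatorIdeal H ↔ IsCompactOperator T := Iff.rfl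

theorem isCompactOperator_starProjection (U : Submodule ℂ H) [FiniteDimensional ℂ U] :
    IsCompactOperator U.starProjection := by
  have : ProperSpace U := FiniteDimensional.proper ℂ U
  have h : IsCompactOperator U.subtypeL := isCompactOperator_of_locallyCompactSpace_rng _
  exact h.comp_clm U.orthogonalProjectionOnto

theorem ContinuousLinearMap.norm_one_sub_starProjection_le (U : Submodule ℂ H)
    [U.HasOrthogonalProjection] : ‖1 - U.starProjection‖ ≤ 1 := by
  rw [← Submodule.starProjection_orthogonal']
  exact Submodule.starProjection_norm_le _

/-- A compact operator is approximated by its compressions to finite-dimensional subspaces of the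
codomain. -/
theorem IsCompactOperator.exists_norm_one_sub_starProjection_mul_le {T : H →L[ℂ] H}
    (hT : IsCompactOperator T) {ε : ℝ} (hε : 0 < ε) :
    ∃ (U : Submodule ℂ H) (_ : FiniteDimensional ℂ U), ‖(1 - U.starProjection) * T‖ ≤ ε := by
  have htb : TotallyBounded (T '' Metric.closedBall 0 1) :=
    (hT.isCompact_closure_image_closedBall 1).totallyBounded.subset subset_closure
  -- The subspace is spanned by a finite `ε`-net of the image of the unit ball; the complementary
  -- projection kills the net.
  obtain ⟨t, ht, hcov⟩ := Metric.totallyBounded_iff.1 htb ε hε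
  have hfd : FiniteDimensional ℂ (Submodule.span ℂ t) := FiniteDimensional.span_of_finite ℂ ht
  refine ⟨Submodule.span ℂ t, hfd, ?_⟩
  refine ContinuousLinearMap.opNorm_le_of_unit_norm hε.le fun x hx => ?_
  obtain ⟨y, hy, hxy⟩ := mem_iUnion₂.1 (hcov ⟨x, by simp [hx], rfl⟩)
  have h1 : (1 - (Submodule.span ℂ t).starProjection) y = 0 := by
    simp [Submodule.starProjection_eq_self_iff.2 (Submodule.subset_span hy)]
  have h2 : ((1 - (Submodule.span ℂ t).starProjection) * T) x =
      (1 - (Submodule.span ℂ t).starProjection) (T x - y) := by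
    rw [map_sub, h1, sub_zero]; rfl
  rw [h2]
  calc _ ≤ ‖1 - (Submodule.span ℂ t).starProjection‖ * ‖T x - y‖ :=
        ContinuousLinearMap.le_opNorm _ _
    _ ≤ 1 * ε := mul_le_mul (ContinuousLinearMap.norm_one_sub_starProjection_le _)
        (by rw [← dist_eq_norm]; exact (Metric.mem_ball.1 hxy).le) (norm_nonneg _) zero_le_one
    _ = ε := one_mul ε

variable [CompleteSpace H]

theorem isClosed_compactOperatorIdeal : IsClosed (compactOperatorIdeal H : Set (H →L[ℂ] H)) :=
  isClosed_setOfPred_isCompactOperator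

/-- **Schauder's theorem** on a Hilbert space. -/
theorem IsCompactOperator.star {T : H →L[ℂ] H} (hT : IsCompactOperator T) :
    IsCompactOperator (star T : H →L[ℂ] H) := by
  rw [← mem_compactOperatorIdeal, ← SetLike.mem_coe, ← isClosed_compactOperatorIdeal.closure_eq,
    Metric.mem_closure_iff]
  intro ε hε
  obtain ⟨U, hU, hUT⟩ := hT.exists_norm_one_sub_starProjection_mul_le (half_pos hε)
  refine ⟨Star.star T * U.starProjection,
    (isCompactOperator_starProjection U).clm_comp (Star.star T), ?_⟩
  have h : Star.star T - Star.star T * U.starProjection =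
      Star.star ((1 - U.starProjection) * T) := by
    rw [star_mul, star_sub, star_one, (isSelfAdjoint_starProjection U).star_eq, mul_sub, mul_one]
  rw [dist_eq_norm, h, norm_star]
  linarith

/-- The approximate units are finite-rank projections adapted to `star T`; taking adjoints moves `1
- p` to the right of `T`. -/
instance : (compactOperatorIdeal H).IsApproximatelyUnital where
  mul_mem_of_left S hT := IsCompactOperator.comp_clm hT S
  isClosed := isClosed_compactOperatorIdeal
  star_mem _ hT := IsCompactOperator.star hT
  exists_approx T hT ε hε := by
    obtain ⟨U, hU, hUT⟩ := (IsCompactOperator.star hT).exists_norm_one_sub_starProjection_mul_le hε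
    refine ⟨U.starProjection, isCompactOperator_starProjection U,
      ContinuousLinearMap.norm_one_sub_starProjection_le U, ?_⟩
    rw [← norm_star, star_mul, star_sub, star_one, (isSelfAdjoint_starProjection U).star_eq]
    exact hUT

end CompactOperators

/-! ### Normal operators and compact perturbations of isometries -/

section Index

variable {H : Type*} [NormedAddCommGroup H] [InnerProductSpace ℂ H]

theorem IsStarNormal.sub_smul_one {A : Type*} [CStarAlgebra A] {N : A} (hN : IsStarNormal N)
    (c : ℂ) : IsStarNormal (N - c • (1 : A)) := by
  rw [isStarNormal_iff, star_sub, star_smul, star_one]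
  have h : Commute (star N) N := hN.star_comm_self
  exact ((h.sub_right ((Commute.one_right _).smul_right c)).sub_left
    ((((Commute.one_left _).smul_left _).sub_right
      (((Commute.one_left _).smul_left _).smul_right _))))

/-- Eigenvectors of a normal operator for distinct eigenvalues are orthogonal. -/
theorem IsStarNormal.inner_eq_zero_of_eigenvectors [CompleteSpace H] {N : H →L[ℂ] H}
    (hN : IsStarNormal N) {a b : ℂ} (hab : a ≠ b) {x y : H} (hx : N x = a • x) (hy : N y = b • y) :
    inner ℂ x y = 0 := by
  have h1 : ContinuousLinearMap.adjoint (N - a • (1 : H →L[ℂ] H)) x = 0 := by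
    rw [ContinuousLinearMap.IsStarNormal.adjoint_apply_eq_zero_iff (hN.sub_smul_one a)]
    simp [hx]
  have h2 : inner ℂ x ((N - a • (1 : H →L[ℂ] H)) y) = 0 := by
    rw [← ContinuousLinearMap.adjoint_inner_left, h1, inner_zero_left]
  have h3 : (N - a • (1 : H →L[ℂ] H)) y = (b - a) • y := by
    simp [hy, sub_smul]
  rw [h3, inner_smul_right, mul_eq_zero] at h2
  exact h2.resolve_left (sub_ne_zero.2 hab.symm)

/-- A compact perturbation of an isometry has no orthonormal sequence of eigenvectors with small
eigenvalues. -/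
theorem IsCompactOperator.not_orthonormal_eigenvectors {V K : H →L[ℂ] H}
    (hV : ∀ x, ‖V x‖ = ‖x‖) (hK : IsCompactOperator K) {e : ℕ → H} (he : Orthonormal ℂ e)
    {c : ℕ → ℂ} (hc : ∀ n, ‖c n‖ ≤ 1 / 4) (hVK : ∀ n, (V + K) (e n) = c n • e n) : False := by
  have hcomp := hK.isCompact_closure_image_closedBall 1
  obtain ⟨z, -, φ, hφ, hlim⟩ := hcomp.tendsto_subseq (x := fun n => K (e n))
    (fun n => subset_closure ⟨e n, by simp [he.1 n], rfl⟩)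
  obtain ⟨n, hn⟩ := Metric.cauchySeq_iff'.1 hlim.cauchySeq (1 / 2) (by norm_num)
  have h1 := hn (n + 1) (Nat.le_succ n)
  rw [dist_eq_norm] at h1
  simp only [Function.comp_apply] at h1
  set i := φ (n + 1)
  set j := φ n
  have hij : i ≠ j := (hφ (Nat.lt_succ_self n)).ne'
  -- Orthonormal vectors are at distance `√2`, but the isometry `V` and the near-convergence of `K
  -- (e n)` along a subsequence force distance at most `1`.
  have h2 : V (e i - e j) = c i • e i - c j • e j - (K (e i) - K (e j)) := by
    rw [← hVK i, ← hVK j, map_sub, add_apply, add_apply]; abel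
  have h3 : ‖e i - e j‖ ≤ 1 / 4 + 1 / 4 + 1 / 2 := by
    rw [← hV, h2]
    refine (norm_sub_le _ _).trans (add_le_add ?_ h1.le)
    refine (norm_sub_le _ _).trans ?_
    rw [norm_smul, norm_smul, he.1, he.1, mul_one, mul_one]
    exact add_le_add (hc i) (hc j)
  have h4 : ‖e i - e j‖ * ‖e i - e j‖ = 2 := by
    rw [@norm_sub_mul_self ℂ, he.1, he.1, he.2 hij]
    norm_num
  nlinarith [norm_nonneg (e i - e j)]

variable [CompleteSpace H]

/-- **Fredholm alternative** for compact perturbations of invertible operators. -/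
theorem IsCompactOperator.isUnit_add_of_injective {A C : H →L[ℂ] H} (hA : IsUnit A)
    (hC : IsCompactOperator C) (hinj : Function.Injective (A + C)) : IsUnit (A + C) := by
  obtain ⟨u, rfl⟩ := hA
  have hT : IsCompactOperator (((u⁻¹ : (H →L[ℂ] H)ˣ) : H →L[ℂ] H) * C) := hC.clm_comp _
  have hfac : (u : H →L[ℂ] H) + C = u * (1 + ((u⁻¹ : (H →L[ℂ] H)ˣ) : H →L[ℂ] H) * C) := by
    rw [mul_add, mul_one, Units.mul_inv_cancel_left]
  rw [hfac]
  refine u.isUnit.mul ?_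
  rcases hT.hasEigenvalue_or_mem_resolventSet (μ := -1) (by norm_num) with h | h
  · obtain ⟨x, hx⟩ := h.exists_hasEigenvector
    have hx1 : (((u⁻¹ : (H →L[ℂ] H)ˣ) : H →L[ℂ] H) * C) x = (-1 : ℂ) • x := hx.apply_eq_smul
    refine absurd (hinj ?_) hx.2
    rw [map_zero, hfac, mul_apply_eq_comp, add_apply, hx1]
    simp
  · rw [spectrum.mem_resolventSet_iff, ← IsUnit.neg_iff] at h
    convert h using 1
    simp [add_comm]

/-- A non-surjective isometry is not a compact perturbation of a normal operator. -/
theorem IsStarNormal.not_isCompactOperator_sub_isometry {V N : H →L[ℂ] H}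
    (hV : star V * V = 1) (hVs : ¬ Function.Surjective V) (hN : IsStarNormal N) :
    ¬ IsCompactOperator (N - V : H →L[ℂ] H) := by
  intro hK
  have hVn : ∀ x, ‖V x‖ = ‖x‖ := (ContinuousLinearMap.norm_map_iff_adjoint_comp_self V).2 hV
  have hV1 : ‖V‖ ≤ 1 := ContinuousLinearMap.opNorm_le_bound _ zero_le_one fun x => by simp [hVn]
  -- Some small `c` is not an eigenvalue of `N`: otherwise the distinct values `1 / (n + 4)` would
  -- give an orthonormal sequence of eigenvectors.
  have hev : ∃ c : ℂ, ‖c‖ ≤ 1 / 4 ∧ ∀ x, N x = c • x → x = 0 := by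
    by_contra! h
    have hc : ∀ n : ℕ, ‖(1 / (n + 4) : ℂ)‖ ≤ 1 / 4 := by
      intro n
      have : ‖(n + 4 : ℂ)‖ = n + 4 := by
        rw [show (n + 4 : ℂ) = ((n + 4 : ℕ) : ℂ) by push_cast; rfl, Complex.norm_natCast]
        push_cast; rfl
      rw [norm_div, norm_one, this]
      exact one_div_le_one_div_of_le (by norm_num) (by linarith [(Nat.cast_nonneg n : (0 : ℝ) ≤ n)])
    choose x hx hx0 using fun n : ℕ => h _ (hc n)
    have hci : ∀ m n : ℕ, m ≠ n → (1 / (m + 4) : ℂ) ≠ 1 / (n + 4) := by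
      intro m n hmn heq
      rw [one_div, one_div, inv_inj] at heq
      exact hmn (by exact_mod_cast add_right_cancel heq)
    have hortho : Orthonormal ℂ fun n => ((‖x n‖ : ℂ)⁻¹) • x n := by
      refine ⟨fun n => norm_smul_inv_norm (hx0 n), fun m n hmn => ?_⟩
      simp only
      rw [inner_smul_left, inner_smul_right,
        hN.inner_eq_zero_of_eigenvectors (hci m n hmn) (hx m) (hx n), mul_zero, mul_zero]
    refine hK.not_orthonormal_eigenvectors hVn hortho hc fun n => ?_
    rw [add_sub_cancel, map_smul, hx, smul_comm]
  obtain ⟨c, hc, hNc⟩ := hev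
  have hcV : ‖c • star V‖ ≤ 1 / 4 := by
    rw [norm_smul, norm_star]; nlinarith [norm_nonneg c, norm_nonneg V]
  have hcV' : ‖star c • V‖ ≤ 1 / 4 := by
    rw [norm_smul, norm_star]; nlinarith [norm_nonneg c, norm_nonneg V]
  have hWn : ∀ x, V x - c • x = 0 → x = 0 := by
    intro x hx
    have h1 := congrArg norm (sub_eq_zero.1 hx)
    rw [hVn, norm_smul] at h1
    have : ‖x‖ = 0 := by nlinarith [norm_nonneg x]
    exact norm_eq_zero.1 this
  have hMadj : ∀ x, star (N - c • (1 : H →L[ℂ] H)) x = 0 → x = 0 := by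
    intro x hx
    rw [ContinuousLinearMap.star_eq_adjoint,
      ContinuousLinearMap.IsStarNormal.adjoint_apply_eq_zero_iff (hN.sub_smul_one c)] at hx
    exact hNc x (sub_eq_zero.1 (by simpa using hx))
  -- With `W = V - c`, this is `star W * W + star (N - V) * W`: an invertible operator close to `1`
  -- plus a compact one. Both factors on the left are injective, normality giving this for the
  -- adjoint, so the Fredholm alternative applies.
  have hfac : star (N - c • (1 : H →L[ℂ] H)) * (V - c • 1) =
      (1 - (c • star V + star c • V - (star c * c) • (1 : H →L[ℂ] H))) +
        star (N - V) * (V - c • 1) := by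
    have h1 : star (V - c • (1 : H →L[ℂ] H)) * (V - c • 1) =
        1 - (c • star V + star c • V - (star c * c) • (1 : H →L[ℂ] H)) := by
      rw [star_sub, star_smul, star_one, sub_mul, mul_sub, mul_sub, hV]
      simp only [smul_mul_assoc, mul_smul_comm, one_mul, mul_one, smul_smul,
        mul_comm c]
      abel
    rw [← h1, ← add_mul, ← star_add]
    congr 2
    abel
  have hunit : IsUnit (1 - (c • star V + star c • V - (star c * c) • (1 : H →L[ℂ] H))) := by
    apply isUnit_one_sub_of_norm_lt_one
    have h1 : ‖(star c * c) • (1 : H →L[ℂ] H)‖ ≤ 1 / 16 := by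
      rw [norm_smul, norm_mul, norm_star]
      have h2 : ‖(1 : H →L[ℂ] H)‖ ≤ 1 := ContinuousLinearMap.norm_id_le
      nlinarith [norm_nonneg c, norm_nonneg (1 : H →L[ℂ] H),
        mul_le_mul hc hc (norm_nonneg c) (by norm_num)]
    have h3 := norm_sub_le (c • star V + star c • V) ((star c * c) • (1 : H →L[ℂ] H))
    have h4 := norm_add_le (c • star V) (star c • V)
    linarith
  have hinj : Function.Injective
      (star (N - c • (1 : H →L[ℂ] H)) * (V - c • 1) : H →L[ℂ] H) := by
    rw [injective_iff_map_eq_zero]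
    intro x hx
    exact hWn x (by simpa using hMadj _ hx)
  have hbij : Function.Bijective
      (star (N - c • (1 : H →L[ℂ] H)) * (V - c • 1) : H →L[ℂ] H) := by
    rw [← ContinuousLinearMap.isUnit_iff_bijective, hfac]
    refine IsCompactOperator.isUnit_add_of_injective hunit ?_ (hfac ▸ hinj)
    exact (IsCompactOperator.star hK).comp_clm _
  -- Since `(1 - c • star V) * V = V - c`, solving `(V - c) x = (1 - c • star V) y` and cancelling
  -- yields `V x = y`.
  have hD : IsUnit (1 - c • star V) := isUnit_one_sub_of_norm_lt_one (by linarith)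
  refine hVs fun y => ?_
  obtain ⟨x, hx⟩ := hbij.2 (star (N - c • (1 : H →L[ℂ] H)) ((1 - c • star V) y))
  refine ⟨x, (ContinuousLinearMap.isUnit_iff_bijective.1 hD).1 ?_⟩
  have h1 : (V - c • (1 : H →L[ℂ] H)) x = (1 - c • star V) y := by
    rw [← sub_eq_zero]
    apply hMadj
    rw [map_sub, sub_eq_zero]
    exact hx
  rw [← h1, ← mul_apply_eq_comp]
  congr 1
  rw [sub_mul, one_mul, smul_mul_assoc, hV]

end Index

/-! ### The unilateral shift and the lifting obstruction -/

/-- There is a Hilbert space with a non-unitary isometry that is unitary modulo compact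
operators. -/
theorem exists_isometry_isCompactOperator_one_sub :
    ∃ (H : Type v) (_ : NormedAddCommGroup H) (_ : InnerProductSpace ℂ H) (_ : CompleteSpace H)
      (V : H →L[ℂ] H), star V * V = 1 ∧ ¬ Function.Surjective V ∧
        IsCompactOperator (1 - V * star V : H →L[ℂ] H) := by
  let H := lp (fun _ : ULift.{v} ℕ => ℂ) 2
  let e : ULift.{v} ℕ → H := fun i => lp.single 2 i 1
  have hin : ∀ i (f : H), inner ℂ (e i) f = f i := fun i f =>
    (lp.inner_single_left i (1 : ℂ) f).trans (by simp)
  have he : ∀ i j, e i j = if j = i then 1 else 0 := fun i j => by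
    simp [e, lp.single_apply, Pi.single_apply]
  let s : ULift.{v} ℕ → ULift.{v} ℕ := fun i => ⟨i.down + 1⟩
  have hs0 : ∀ i, s i ≠ ⟨0⟩ := fun i h => by simpa [s] using congrArg ULift.down h
  have hs : ∀ i j, i ≠ j → s i ≠ s j := fun i j hij h =>
    hij (ULift.down_injective (by simpa [s] using congrArg ULift.down h))
  have hon : Orthonormal ℂ fun i => e (s i) := by
    refine ⟨fun i => (lp.norm_single (by norm_num) _ _).trans norm_one, fun i j hij => ?_⟩
    beta_reduce
    rw [hin, he, if_neg (hs i j hij)]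
  let V : H →L[ℂ] H := hon.orthogonalFamily.linearIsometry.toContinuousLinearMap
  have hVe : ∀ i, V (e i) = e (s i) := fun i => by
    change hon.orthogonalFamily.linearIsometry (lp.single 2 i 1) = _
    rw [OrthogonalFamily.linearIsometry_apply_single]
    simp
  have hVV : star V * V = 1 :=
    (ContinuousLinearMap.norm_map_iff_adjoint_comp_self V).1 fun x =>
      hon.orthogonalFamily.linearIsometry.norm_map x
  have hV0 : star V (e ⟨0⟩) = 0 := by
    ext i
    rw [← hin, ContinuousLinearMap.star_eq_adjoint, ContinuousLinearMap.adjoint_inner_right, hVe,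
      hin, he, if_neg (hs0 i)]
    rfl
  refine ⟨H, inferInstance, inferInstance, inferInstance, V, hVV, fun hsurj => ?_, ?_⟩
  · obtain ⟨x, hx⟩ := hsurj (e ⟨0⟩)
    have h1 : star V (V x) = x := congrArg (fun T : H →L[ℂ] H => T x) hVV
    rw [hx, hV0] at h1
    rw [← h1, map_zero] at hx
    have h2 := he ⟨0⟩ ⟨0⟩
    rw [← hx] at h2
    simp at h2
  -- Every basis vector but the zeroth is in the range of `V`, and `star V * (1 - V * star V) = 0`,
  -- so only the zeroth coordinate survives.
  · have hrange : ∀ x, (1 - V * star V) x ∈ Submodule.span ℂ {e ⟨0⟩} := by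
      intro x
      rw [Submodule.mem_span_singleton]
      refine ⟨((1 - V * star V) x) ⟨0⟩, ?_⟩
      ext ⟨i⟩
      rw [lp.coeFn_smul, Pi.smul_apply, he]
      cases i with
      | zero => simp
      | succ i =>
        have h1 : e ⟨i + 1⟩ = V (e ⟨i⟩) := (hVe ⟨i⟩).symm
        have h2 : star V ((1 - V * star V) x) = 0 := by
          have h3 : star V * (1 - V * star V) = 0 := by
            rw [mul_sub, mul_one, ← mul_assoc, hVV, one_mul, sub_self]
          exact congrArg (fun T : H →L[ℂ] H => T x) h3
        rw [← hin ⟨i + 1⟩, h1, ← ContinuousLinearMap.adjoint_inner_right,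
          ← ContinuousLinearMap.star_eq_adjoint, h2, inner_zero_right, if_neg (by simp), smul_zero]
    have hfac : (1 - V * star V : H →L[ℂ] H) =
        (Submodule.span ℂ {e ⟨0⟩}).starProjection * (1 - V * star V) := by
      ext1 x
      exact (Submodule.starProjection_eq_self_iff.2 (hrange x)).symm
    rw [hfac]
    exact (isCompactOperator_starProjection (Submodule.span ℂ {e ⟨0⟩})).comp_clm _

theorem isVonNeumann_continuousLinearMap (H : Type v) [NormedAddCommGroup H]
    [InnerProductSpace ℂ H] [CompleteSpace H] : IsVonNeumann (H →L[ℂ] H) := by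
  refine ⟨H, inferInstance, inferInstance, inferInstance,
    ⟨⊤, univ_subset_iff.1 subset_centralizer_centralizer⟩, ⟨?_⟩⟩
  exact (StarAlgEquiv.ofBijective ((⊤ : StarSubalgebra ℂ (H →L[ℂ] H)).subtype)
    ⟨Subtype.val_injective, fun x => ⟨⟨x, trivial⟩, rfl⟩⟩).symm

theorem StarAlgHom.apply_exp {A B : Type*} [CStarAlgebra A] [CStarAlgebra B] (f : A →⋆ₐ[ℂ] B)
    (a : A) : f (NormedSpace.exp a) = NormedSpace.exp (f a) := by
  let +nondep : NormedAlgebra ℚ A := .restrictScalars ℚ ℂ A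
  let +nondep : NormedAlgebra ℚ B := .restrictScalars ℚ ℂ B
  exact NormedSpace.map_exp f (AddMonoidHomClass.continuous_of_bound f 1 fun x => by
    simpa using NonUnitalStarAlgHom.norm_apply_le f x) a

/-- A self-adjoint element lifts through a surjective ⋆-homomorphism to a self-adjoint element. -/
theorem StarAlgHom.exists_isSelfAdjoint_apply_eq {A B : Type*} [CStarAlgebra A] [CStarAlgebra B]
    (f : A →⋆ₐ[ℂ] B) (hf : Function.Surjective f) {b : B} (hb : IsSelfAdjoint b) :
    ∃ a, IsSelfAdjoint a ∧ f a = b := by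
  obtain ⟨a, rfl⟩ := hf b
  refine ⟨(1 / 2 : ℂ) • (a + star a), ?_, ?_⟩
  · rw [isSelfAdjoint_iff, star_smul, star_add, star_star, add_comm]
    congr 1
    simp
  · rw [map_smul, map_add, map_star, hb.star_eq, ← two_smul ℂ, smul_smul]
    norm_num

/-- If `C(K)` is `W⋆`-`C⋆`-projective, then no continuous function on `K` restricts to a function of
winding number one along a loop in `K`. -/
theorem IsWStarCStarProjective.false_of_winding_one {K : Type u} [TopologicalSpace K]
    [CompactSpace K] (hK : IsWStarCStarProjective.{u, v} C(K, ℂ)) (c : C(Circle, K))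
    (k : C(Circle, ℝ)) (f : C(K, ℂ))
    (hf : ∀ z, f (c z) = z * Complex.exp (Complex.I * k z)) : False := by
  obtain ⟨H, _, _, _, V, hVV, hVs, hVc⟩ := exists_isometry_isCompactOperator_one_sub.{v}
  let J := compactOperatorIdeal H
  let π : (H →L[ℂ] H) →⋆ₐ[ℂ] (H →L[ℂ] H) ⧸ J := Ideal.IsApproximatelyUnital.mkStarAlgHom J
  have hπ : Function.Surjective π := Ideal.IsApproximatelyUnital.mkStarAlgHom_surjective J
  have hu : π V ∈ unitary ((H →L[ℂ] H) ⧸ J) := by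
    refine Unitary.mem_iff.2 ⟨?_, ?_⟩
    · rw [← map_star, ← map_mul, hVV, map_one]
    · rw [← map_star, ← map_mul, ← map_one π]
      exact ((Ideal.IsApproximatelyUnital.mkStarAlgHom_eq_iff J).2 hVc).symm
  have hnormal : IsStarNormal (π V) := by
    rw [isStarNormal_iff, commute_iff_eq, (Unitary.mem_iff.1 hu).1, (Unitary.mem_iff.1 hu).2]
  -- Restriction to the spectrum followed by the functional calculus gives a map from `C(Circle, ℂ)`
  -- sending the coordinate to `π V`.
  let ι : C(spectrum ℂ (π V), Circle) :=
    ⟨fun z => ⟨z, spectrum.subset_circle_of_unitary hu z.2⟩, by fun_prop⟩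
  let ρ : C(Circle, ℂ) →⋆ₐ[ℂ] (H →L[ℂ] H) ⧸ J :=
    (cfcHom hnormal).comp (ContinuousMap.compStarAlgHom' ℂ ℂ ι)
  let w : C(Circle, ℂ) := ⟨fun z => z, by fun_prop⟩
  let l : C(Circle, ℂ) := ⟨fun z => k z, by fun_prop⟩
  have hρw : ρ w = π V := cfcHom_id hnormal
  have hl : IsSelfAdjoint (ρ l) := by
    rw [isSelfAdjoint_iff, ← map_star]
    congr 1
    ext z
    exact Complex.conj_ofReal _
  obtain ⟨a, ha, hπa⟩ := π.exists_isSelfAdjoint_apply_eq hπ hl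
  obtain ⟨ψ, hψ⟩ := hK (H →L[ℂ] H) ((H →L[ℂ] H) ⧸ J) (isVonNeumann_continuousLinearMap H) trivial
    π hπ (ρ.comp (ContinuousMap.compStarAlgHom' ℂ ℂ c))
  have hfc : ContinuousMap.compStarAlgHom' ℂ ℂ c f = w * NormedSpace.exp (Complex.I • l) := by
    ext z
    have h1 := (ContinuousMap.evalStarAlgHom ℂ ℂ z).apply_exp (Complex.I • l)
    change (NormedSpace.exp (Complex.I • l)) z = NormedSpace.exp (Complex.I * k z) at h1
    change f (c z) = z * (NormedSpace.exp (Complex.I • l)) z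
    rw [h1, hf, Complex.exp_eq_exp_ℂ]
  -- The exponential factor lifts to a genuine unitary because its real logarithm lifts to a
  -- self-adjoint element. Thus `V * E` is still a non-surjective isometry, while `ψ f` is normal as
  -- an image from a commutative algebra.
  let E := selfAdjoint.expUnitary ⟨a, ha⟩
  have hE : π E = ρ (NormedSpace.exp (Complex.I • l)) := by
    rw [selfAdjoint.expUnitary_coe, StarAlgHom.apply_exp, StarAlgHom.apply_exp, map_smul, map_smul,
      hπa]
  have hN : IsStarNormal (ψ f) := by
    rw [isStarNormal_iff, ← map_star]
    exact (Commute.all _ _).map ψ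
  have hVE : star (V * (E : H →L[ℂ] H)) * (V * E) = 1 := by
    rw [star_mul, mul_assoc, ← mul_assoc (star V), hVV, one_mul, Unitary.coe_star_mul_self]
  refine hN.not_isCompactOperator_sub_isometry hVE ?_ ?_
  · intro hs
    refine hVs fun y => ?_
    obtain ⟨x, hx⟩ := hs y
    exact ⟨_, hx⟩
  · refine (Ideal.IsApproximatelyUnital.mkStarAlgHom_eq_iff J).1 ?_
    have h1 : π (ψ f) = ρ (ContinuousMap.compStarAlgHom' ℂ ℂ c f) :=
      congrArg (fun χ : C(K, ℂ) →⋆ₐ[ℂ] (H →L[ℂ] H) ⧸ J => χ f) hψ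
    change π (ψ f) = π (V * E)
    rw [h1, hfc, map_mul, map_mul, hρw, hE]

/-! ### A function of winding number one -/

/-- A loop, parametrized by the unit interval, factors through the circle. -/
theorem exists_circle_comp_exp_eq {Y : Type*} [TopologicalSpace Y] {y : Y} (γ : Path y y) :
    ∃ g : C(Circle, Y), ∀ t : unitInterval, g (Circle.exp (2 * Real.pi * t)) = γ t := by
  have h01 : γ.extend 0 = γ.extend (0 + 1) := by simp
  have hcont : Continuous (AddCircle.liftIco (1 : ℝ) 0 γ.extend) :=
    AddCircle.liftIco_continuous h01 γ.continuous_extend.continuousOn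
  let e := (AddCircle.homeomorphCircle (T := 1) one_ne_zero).symm
  refine ⟨⟨fun z => AddCircle.liftIco (1 : ℝ) 0 γ.extend (e z), hcont.comp e.continuous⟩,
    fun t => ?_⟩
  have he : e (Circle.exp (2 * Real.pi * t)) = ((t : ℝ) : AddCircle (1 : ℝ)) := by
    rw [Homeomorph.symm_apply_eq, AddCircle.homeomorphCircle_apply, AddCircle.toCircle_apply_mk]
    simp
  change AddCircle.liftIco (1 : ℝ) 0 γ.extend (e _) = _
  rw [he]
  rcases t.2.2.lt_or_eq with h | h
  · rw [AddCircle.liftIco_coe_apply ⟨t.2.1, by simpa using h⟩, Path.extend_apply _ t.2]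
  · have ht : t = 1 := Subtype.ext h
    have h1 : ((1 : ℝ) : AddCircle (1 : ℝ)) = ((0 : ℝ) : AddCircle (1 : ℝ)) := by
      simp [AddCircle.coe_period]
    rw [ht, show ((1 : unitInterval) : ℝ) = 1 from rfl, h1, AddCircle.liftIco_coe_apply (by simp)]
    simp

theorem exists_unitInterval_circleExp_eq (z : Circle) :
    ∃ t : unitInterval, Circle.exp (2 * Real.pi * t) = z := by
  obtain ⟨a, rfl⟩ := Circle.exp_surjective z
  refine ⟨⟨Int.fract (a / (2 * Real.pi)), Int.fract_nonneg _, (Int.fract_lt_one _).le⟩, ?_⟩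
  refine Circle.exp_eq_exp.2 ⟨-⌊a / (2 * Real.pi)⌋, ?_⟩
  have := Real.pi_ne_zero
  change 2 * Real.pi * Int.fract (a / (2 * Real.pi)) = _
  rw [← Int.self_sub_floor]
  push_cast
  field_simp
  ring

/-- If `C(K)` is `W⋆`-`C⋆`-projective for a compact metric locally connected `K`, then points of the
intersection of two connected open subsets of `K` are joined by connected open sets within it. -/
theorem IsWStarCStarProjective.hasConnectedIntersections {K : Type u} [MetricSpace K]
    [CompactSpace K] [LocallyConnectedSpace K] (hK : IsWStarCStarProjective.{u, v} C(K, ℂ)) :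
    HasConnectedIntersections K := by
  have := locallyPathConnectedSpace_of_completeSpace K
  intro P Q hP hPc hQ hQc x hx y hy
  have hPQ : IsOpen (P ∩ Q) := hP.inter hQ
  set R := connectedComponentIn (P ∩ Q) x with hR
  have hRo : IsOpen R := hPQ.connectedComponentIn
  have hxR : x ∈ R := mem_connectedComponentIn hx
  by_cases hyR : y ∈ R
  · exact ⟨R, connectedComponentIn_subset _ _, hRo, isPreconnected_connectedComponentIn, hxR, hyR⟩
  exfalso
  obtain ⟨p, hp⟩ := (hP.isConnected_iff_isPathConnected.1 ⟨⟨x, hx.1⟩, hPc⟩).joinedIn x hx.1 y hy.1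
  obtain ⟨q, hq⟩ := (hQ.isConnected_iff_isPathConnected.1 ⟨⟨x, hx.2⟩, hQc⟩).joinedIn y hy.2 x hx.2
  have hpc : IsClosed (range p) := (isCompact_range p.continuous).isClosed
  have hqc : IsClosed (range q) := (isCompact_range q.continuous).isClosed
  have hI : range p ∩ range q ⊆ P ∩ Q := by
    rintro _ ⟨⟨s, rfl⟩, t, ht⟩
    exact ⟨hp s, ht ▸ hq t⟩
  have hSo : IsOpen (⋃ z ∈ (P ∩ Q) \ R, connectedComponentIn (P ∩ Q) z) :=
    isOpen_biUnion fun _ _ => hPQ.connectedComponentIn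
  have hSR : ∀ z ∈ P ∩ Q, z ∈ R ↔ z ∉ ⋃ z ∈ (P ∩ Q) \ R, connectedComponentIn (P ∩ Q) z := by
    intro z hz
    constructor
    · intro hzR hzS
      obtain ⟨z', hz', hzz'⟩ := mem_iUnion₂.1 hzS
      apply hz'.2
      rw [hR, connectedComponentIn_eq hzR, ← connectedComponentIn_eq hzz']
      exact mem_connectedComponentIn hz'.1
    · intro hzS
      by_contra hzR
      exact hzS (mem_biUnion ⟨hz, hzR⟩ (mem_connectedComponentIn hz))
  set S := ⋃ z ∈ (P ∩ Q) \ R, connectedComponentIn (P ∩ Q) z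
  -- `R` and the union `S` of the other components are open and partition `P ∩ Q`, so `n` takes only
  -- the values `0` and `1` where the two paths meet. Hence `exp (2πi n)` on `range p` agrees there
  -- with `1` on `range q`.
  obtain ⟨n, hn0, hn1, -⟩ := exists_continuous_zero_one_of_isClosed
    (s := (range p ∩ range q) \ S) (t := (range p ∩ range q) \ R)
    ((hpc.inter hqc).sdiff hSo) ((hpc.inter hqc).sdiff hRo)
    (disjoint_left.2 fun z hz hz' => hz'.2 ((hSR z (hI hz.1)).2 hz.2))
  have hxI : x ∈ range p ∩ range q := ⟨⟨0, p.source⟩, ⟨1, q.target⟩⟩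
  have hyI : y ∈ range p ∩ range q := ⟨⟨1, p.target⟩, ⟨0, q.source⟩⟩
  have hnx : n x = 0 := hn0 ⟨hxI, (hSR x hx).1 hxR⟩
  have hny : n y = 1 := hn1 ⟨hyI, hyR⟩
  classical
  let f₀ : K → ℂ := fun z => if z ∈ range p then Complex.exp (2 * Real.pi * Complex.I * n z) else 1
  have hf₀q : ∀ z ∈ range q, f₀ z = 1 := by
    intro z hz
    by_cases hzp : z ∈ range p
    · have hzI : z ∈ range p ∩ range q := ⟨hzp, hz⟩
      simp only [f₀, hzp, if_true]
      by_cases hzR : z ∈ R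
      · have : n z = 0 := hn0 ⟨hzI, (hSR z (hI hzI)).1 hzR⟩
        simp [this]
      · have : n z = 1 := hn1 ⟨hzI, hzR⟩
        simp [this, Complex.exp_two_pi_mul_I]
    · exact if_neg hzp
  have hf₀p : ∀ z ∈ range p, f₀ z = Complex.exp (2 * Real.pi * Complex.I * n z) := fun z hz => by
    simp only [f₀, hz, if_true]
  have hf₀ : ContinuousOn f₀ (range p ∪ range q) := by
    refine ContinuousOn.union_of_isClosed ?_ ?_ hpc hqc
    · refine ContinuousOn.congr (Continuous.continuousOn ?_) hf₀p
      fun_prop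
    · exact continuousOn_const.congr hf₀q
  obtain ⟨f, hf⟩ := ContinuousMap.exists_restrict_eq (hpc.union hqc)
    (⟨(range p ∪ range q).domRestrict f₀, hf₀.domRestrict⟩ : C(↥(range p ∪ range q), ℂ))
  have hff : ∀ z ∈ range p ∪ range q, f z = f₀ z := fun z hz => DFunLike.congr_fun hf ⟨z, hz⟩
  -- A continuous argument of `f` along the loop, in turns: it goes from `0` to `1` along `p` and
  -- stays constant along `q`. Subtracting `t` leaves a closed path, which descends to the exponent
  -- `k` on the circle.
  let θ : Path (n x) (n y) := (p.map n.continuous).trans (Path.refl (n y))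
  have hθ : ∀ t, f ((p.trans q) t) = Complex.exp (2 * Real.pi * Complex.I * θ t) := by
    intro t
    simp only [θ, Path.trans_apply]
    split_ifs with h
    · rw [hff _ (.inl ⟨_, rfl⟩), hf₀p _ ⟨_, rfl⟩]
      rfl
    · rw [hff _ (.inr ⟨_, rfl⟩), hf₀q _ ⟨_, rfl⟩, Path.refl_apply, hny]
      simp [Complex.exp_two_pi_mul_I]
  let η : Path (0 : ℝ) 0 :=
    { toFun := fun t => 2 * Real.pi * (θ t - t)
      continuous_toFun := by fun_prop
      source' := by simp [hnx]
      target' := by simp [hny] }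
  obtain ⟨c, hc⟩ := exists_circle_comp_exp_eq (p.trans q)
  obtain ⟨k, hk⟩ := exists_circle_comp_exp_eq η
  refine hK.false_of_winding_one c k f fun z => ?_
  obtain ⟨t, rfl⟩ := exists_unitInterval_circleExp_eq z
  rw [hc, hk, hθ, Circle.coe_exp, ← Complex.exp_add]
  congr 1
  change _ = _ + Complex.I * ((2 * Real.pi * (θ t - t) : ℝ) : ℂ)
  push_cast
  ring

theorem proposition4p9 (K : Type u) [MetricSpace K] [CompactSpace K] [ConnectedSpace K]
    [LocallyConnectedSpace K] (hK : IsWStarCStarProjective.{u, v} C(K, ℂ)) :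
    coveringDim K ≤ 1 :=
  coveringDim_le_one_of_hasConnectedIntersections hK.hasConnectedIntersections
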